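/- **Theorem.** Let $c>0$, $\sigma>0$, $t\in\mathbb R$ and $W_\sigma(x;t)=|x|^{2\sigma+1}\exp\bigl(-[cx^6+t(x^4-x^2)]\bigr)$ on $\mathbb R$. Let $\mathcal S_n(x;t)$, $n\ge 0$, be the monic orthogonal polynomials for $W_\sigma$ (obtained from $1,x,x^2,\dots$ by Gram–Schmidt): $\mathcal S_n$ is monic of degree $n$, all products $\mathcal S_m\mathcal S_nW_\sigma$ are integrable, and $\int_{\mathbb R}\mathcal S_m\mathcal S_nW_\sigma\,dx=\Gamma_n\delta_{mn}$ with $\Gamma_n>0$. Put $\mathcal S_{-1}=0$ and let $\gamma_n=\frac1{\Gamma_{n-1}}\int_{\mathbb R} x\,\mathcal S_n\mathcal S_{n-1}W_\sigma\,dx$ for $n\ge1$ and $\gamma_n=0$ for $n\le 0$; these are the recurrence coefficients, $\mathcal S_{n+1}=x\mathcal S_n-\gamma_n\mathcal S_{n-1}$ for $n\ge 0$. Write $\Xi_n=\gamma_n(\gamma_{n-1}+\gamma_n+\gamma_{n+1})$, $\Omega_n=\frac{1-(-1)^n}2$, $v=-\ln W_\sigma$, so that $v'(x)=6cx^5+t(4x^3-2x)-\frac{2\sigma+1}{x}$,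 and define the ladder functions $$\mathcal A_n(x)=\frac1{\Gamma_n}\int_{\mathbb R}\frac{v'(x)-v'(\tau)}{x-\tau}\,\mathcal S_n(\tau)^2\,W_\sigma(\tau;t)\,d\tau,\qquad \mathcal B_n(x)=\frac1{\Gamma_{n-1}}\int_{\mathbb R}\frac{v'(x)-v'(\tau)}{x-\tau}\,\mathcal S_n(\tau)\mathcal S_{n-1}(\tau)\,W_\sigma(\tau;t)\,d\tau ,$$ with $\mathcal B_0=0$ and $\mathcal A_{-1}=0$. Put $$D_n(x)=6cx^4+6c(\gamma_n+\gamma_{n+1})x^2+6c(\Xi_{n+1}+\Xi_n)-2t+4t(x^2+\gamma_n+\gamma_{n+1}).$$ Then for every $n\ge 0$ the polynomial $D_n$ has only finitely many real zeros, and for every real $x\ne0$ with $D_n(x)\neq0$ one has $\mathcal A_n(x)=D_n(x)$ and $$\mathcal S_n''(x;t)+\tilde U_n(x;t)\,\mathcal S_n'(x;t)+\tilde W_n(x;t)\,\mathcal S_n(x;t)=0,$$ with the coefficients, rational in $x$, $$\tilde U_n=-6cx^5-t(4x^3-2x)+\frac{2\sigma+1}{x}-\frac{24cx^3+2[6c(\gamma_n+\gamma_{n+1})+4t]x}{D_n(x)},$$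 $$\begin{aligned}\tilde W_n={}&18c\gamma_nx^2+6c\,\Xi_n-\frac{(2\sigma+1)\Omega_n}{x^2}+4t\gamma_n\\&+\gamma_n D_n(x)\Bigl(6cx^4+6c(\gamma_n+\gamma_{n-1})x^2+6c(\Xi_{n-1}+\Xi_n)-2t+4t(x^2+\gamma_n+\gamma_{n-1})\Bigr)\\&-\Bigl(6cx^5+(6c\gamma_n+4t)x^3-\frac{2\sigma+1}{x}+(6c\,\Xi_n+4t\gamma_n-2t)x+\frac{(2\sigma+1)\Omega_n}{x}+\frac{24cx^3+2[6c(\gamma_n+\gamma_{n+1})+4t]x}{D_n(x)}\Bigr)\\&\qquad\times\Bigl(6c\gamma_nx^3+(6c\,\Xi_n+4t\gamma_n)x+\frac{(2\sigma+1)\Omega_n}{x}\Bigr).\end{aligned}$$ Moreover, at every such $x$, $$\tilde U_n=-v'-\frac{\mathcal A_n'}{\mathcal A_n},\qquad \tilde W_n=-\mathcal B_n\Bigl(v'+\mathcal B_n+\frac{\mathcal A_n'}{\mathcal A_n}\Bigr)+\gamma_n\mathcal A_n\mathcal A_{n-1}+\mathcal B_n'.$$ -/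

import Mathlib

namespace SexticFreud

noncomputable section

/-- The weight `W_σ(x;t) = |x|^(2σ+1) exp(-[c x^6 + t (x^4 - x^2)])`. -/
def weight (c t σ x : ℝ) : ℝ :=
  |x| ^ (2 * σ + 1) * Real.exp (-(c * x ^ 6 + t * (x ^ 4 - x ^ 2)))

/-- The pairing `⟨p, q⟩ = ∫ p q W_σ dx` over the real line. -/
def pairing (c t σ : ℝ) (p q : Polynomial ℝ) : ℝ :=
  ∫ x : ℝ, p.eval x * q.eval x * weight c t σ x

/-- The monic orthogonal polynomials, obtained from `1, x, x^2, …` by the Gram-Schmidt process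
without normalization. -/
def monicOP (c t σ : ℝ) (n : ℕ) : Polynomial ℝ :=
  Polynomial.X ^ n - ∑ k : Fin n,
    Polynomial.C (pairing c t σ (Polynomial.X ^ n) (monicOP c t σ k) /
      pairing c t σ (monicOP c t σ k) (monicOP c t σ k)) * monicOP c t σ k
termination_by n
decreasing_by exact k.2

/-- The polynomials `S_n`, with the convention `S_n = 0` for `n < 0`. -/
def S (c t σ : ℝ) : ℤ → Polynomial ℝ
  | Int.ofNat n => monicOP c t σ n
  | Int.negSucc _ => 0

/-- The squared norm `Γ_n = ⟨S_n, S_n⟩`. -/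
def normSq (c t σ : ℝ) (n : ℤ) : ℝ := pairing c t σ (S c t σ n) (S c t σ n)

/-- The recurrence coefficient `γ_n = ⟨x S_n, S_{n-1}⟩ / Γ_{n-1}` for `n ≥ 1`,
and `γ_n = 0` for `n ≤ 0`. -/
def γ (c t σ : ℝ) (n : ℤ) : ℝ :=
  if n ≤ 0 then 0
  else pairing c t σ (Polynomial.X * S c t σ n) (S c t σ (n - 1)) / normSq c t σ (n - 1)

/-- `Ξ_n = γ_n (γ_{n-1} + γ_n + γ_{n+1})`. -/
def Ξ (c t σ : ℝ) (n : ℤ) : ℝ :=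
  γ c t σ n * (γ c t σ (n - 1) + γ c t σ n + γ c t σ (n + 1))

/-- `Ω_n = (1 - (-1)^n) / 2`. -/
def Ω (n : ℤ) : ℝ := (1 - (-1 : ℝ) ^ n) / 2

/-- The potential `v = -ln W_σ`. -/
def v (c t σ x : ℝ) : ℝ := -Real.log (weight c t σ x)

/-- The ladder function
`A_n(x) = (1/Γ_n) ∫ (v'(x) - v'(τ)) / (x - τ) S_n(τ)^2 W_σ(τ) dτ`. -/
def A (c t σ : ℝ) (n : ℤ) (x : ℝ) : ℝ :=
  1 / normSq c t σ n * ∫ τ : ℝ, (deriv (v c t σ) x - deriv (v c t σ) τ) / (x - τ) *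
    (S c t σ n).eval τ ^ 2 * weight c t σ τ

/-- The ladder function
`B_n(x) = (1/Γ_{n-1}) ∫ (v'(x) - v'(τ)) / (x - τ) S_n(τ) S_{n-1}(τ) W_σ(τ) dτ`
(it is zero for `n = 0`, because `S_{-1} = 0`). -/
def B (c t σ : ℝ) (n : ℤ) (x : ℝ) : ℝ :=
  1 / normSq c t σ (n - 1) * ∫ τ : ℝ, (deriv (v c t σ) x - deriv (v c t σ) τ) / (x - τ) *
    ((S c t σ n).eval τ * (S c t σ (n - 1)).eval τ) * weight c t σ τ

/-- The explicit polynomial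
`6cx^4 + 6c(γ_n+γ_{n+1})x^2 + 6c(Ξ_{n+1}+Ξ_n) - 2t + 4t(x^2+γ_n+γ_{n+1})`. -/
def D (c t σ : ℝ) (n : ℤ) (x : ℝ) : ℝ :=
  6 * c * x ^ 4 + 6 * c * (γ c t σ n + γ c t σ (n + 1)) * x ^ 2
    + 6 * c * (Ξ c t σ (n + 1) + Ξ c t σ n) - 2 * t
    + 4 * t * (x ^ 2 + γ c t σ n + γ c t σ (n + 1))

/-- The explicit coefficient of the first derivative in the differential equation. -/
def U (c t σ : ℝ) (n : ℤ) (x : ℝ) : ℝ :=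
  -6 * c * x ^ 5 - t * (4 * x ^ 3 - 2 * x) + (2 * σ + 1) / x
    - (24 * c * x ^ 3 + 2 * (6 * c * (γ c t σ n + γ c t σ (n + 1)) + 4 * t) * x) / D c t σ n x

/-- The explicit coefficient of the function itself in the differential equation. -/
def W (c t σ : ℝ) (n : ℤ) (x : ℝ) : ℝ :=
  18 * c * γ c t σ n * x ^ 2 + 6 * c * Ξ c t σ n - (2 * σ + 1) * Ω n / x ^ 2 + 4 * t * γ c t σ n
    + γ c t σ n
      * (6 * c * x ^ 4 + 6 * c * (γ c t σ n + γ c t σ (n + 1)) * x ^ 2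
          + 6 * c * (Ξ c t σ (n + 1) + Ξ c t σ n) - 2 * t
          + 4 * t * (x ^ 2 + γ c t σ n + γ c t σ (n + 1)))
      * (6 * c * x ^ 4 + 6 * c * (γ c t σ n + γ c t σ (n - 1)) * x ^ 2
          + 6 * c * (Ξ c t σ (n - 1) + Ξ c t σ n) - 2 * t
          + 4 * t * (x ^ 2 + γ c t σ n + γ c t σ (n - 1)))
    - (6 * c * x ^ 5 + (6 * c * γ c t σ n + 4 * t) * x ^ 3 - (2 * σ + 1) / x
          + (6 * c * Ξ c t σ n + 4 * t * γ c t σ n - 2 * t) * x + (2 * σ + 1) * Ω n / x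
          + (24 * c * x ^ 3 + 2 * (6 * c * (γ c t σ n + γ c t σ (n + 1)) + 4 * t) * x)
              / D c t σ n x)
      * (6 * c * γ c t σ n * x ^ 3 + (6 * c * Ξ c t σ n + 4 * t * γ c t σ n) * x
          + (2 * σ + 1) * Ω n / x)

/-- The sequence `p` consists of the monic orthogonal polynomials for the weight `W_σ(·;t)`:
`p_n` is monic of degree `n`, the products `p_m p_n W_σ` are integrable, `p_m ⟂ p_n` for `m ≠ n`,
and the squared norms are positive. -/
structure IsMonicOrthogonal (c t σ : ℝ) (p : ℕ → Polynomial ℝ) : Prop where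
  monic : ∀ n, (p n).Monic
  natDegree : ∀ n, (p n).natDegree = n
  integrable : ∀ m n, MeasureTheory.Integrable
    (fun x : ℝ => (p m).eval x * (p n).eval x * weight c t σ x)
  orthogonal : ∀ m n, m ≠ n → pairing c t σ (p m) (p n) = 0
  pos : ∀ n, 0 < pairing c t σ (p n) (p n)

end

end SexticFreud

namespace SexticFreud

open MeasureTheory Polynomial

noncomputable section

/-! ### The weight -/

/-! The method is that of ladder operators. The divided difference of `v'` is a polynomial in `τ`
plus `(2σ+1)/(xτ)`, so `A_n` and `B_n` are values of one linear functional `ladder x`, built from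
the moments of `W_σ` and of `W_σ/x`. Integration by parts becomes `ladder_sub_mul`: the functional
sends `(x - τ) f` to `v'(x) ∫ f W_σ - ∫ f' W_σ`.

Taking `f` to be the Christoffel-Darboux kernel times `S_n` gives `S_n' = -B_n S_n + γ_n A_n
S_{n-1}` (`eval_derivative_S`). Taking `f = S_n²` gives `B_{n+1} + B_n = x A_n - v'`
(`B_succ_add_B`). Together they express `S_{n-1}'` through `S_{n-1}` and `S_n`. Differentiating the
first relation and eliminating `S_{n-1}` yields the equation in ladder form
(`ladder_differential_equation`); no further compatibility condition is needed.

The explicit coefficients come from evaluating `A_n` and `B_n`: parity kills half of the moments,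
and the three-term recurrence supplies the rest (`A_eq_D`, `B_eq_explicitB`). -/

theorem exists_exp_neg_sextic_le {c : ℝ} (hc : 0 < c) (t : ℝ) :
    ∃ C : ℝ, ∀ x : ℝ,
      Real.exp (-(c * x ^ 6 + t * (x ^ 4 - x ^ 2))) ≤ C * Real.exp (-1 * x ^ 2) := by
  -- With `y = x²`, the constant `a` bounds the `t`-terms together with the extra `y` that the
  -- Gaussian factor costs. For `y ≥ K` one has `c y ≥ 2a` and `y ≥ 1`, so the cubic dominates; for
  -- `y ≤ K` everything is bounded by `a K² + a K`.
  set a := |t| + 1 with ha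
  have ha1 : 1 ≤ a := by have := abs_nonneg t; linarith
  set K := 2 * a / c + 1 with hK
  have hK1 : 1 ≤ K := by
    have : 0 < 2 * a / c := by positivity
    linarith
  refine ⟨Real.exp (a * K ^ 2 + a * K), fun x => ?_⟩
  rw [← Real.exp_add]
  apply Real.exp_le_exp.mpr
  obtain ⟨y, hy⟩ : ∃ y, y = x ^ 2 := ⟨_, rfl⟩
  have hy0 : 0 ≤ y := hy ▸ sq_nonneg x
  have h6 : x ^ 6 = y ^ 3 := by rw [hy]; ring
  have h4 : x ^ 4 = y ^ 2 := by rw [hy]; ring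
  rw [h6, h4, ← hy]
  have ht1 : -(t * y ^ 2) ≤ a * y ^ 2 := by
    have := neg_abs_le t
    nlinarith [sq_nonneg y]
  have ht2 : t * y + y ≤ a * y := by
    have := le_abs_self t
    nlinarith
  have hcy : 0 ≤ c * y ^ 3 := by positivity
  suffices a * y ^ 2 + a * y ≤ c * y ^ 3 + (a * K ^ 2 + a * K) by linarith
  rcases le_total y K with h | h
  · have : y ^ 2 ≤ K ^ 2 := by gcongr
    nlinarith
  · have h1 : 2 * a ≤ c * y := by
      have : c * K ≤ c * y := by gcongr
      have e : c * K = 2 * a + c := by rw [hK]; field_simp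
      linarith
    have h2 : 2 * a * y ^ 2 ≤ c * y * y ^ 2 := by gcongr
    have h3 : y ≤ y ^ 2 := by nlinarith
    have h4 : a * y ≤ a * y ^ 2 := by gcongr
    have : 0 ≤ a * K ^ 2 + a * K := by positivity
    nlinarith

theorem integrable_pow_mul_abs_rpow_mul_exp {c : ℝ} (hc : 0 < c) (t : ℝ) {s : ℝ} (hs : 0 ≤ s)
    (k : ℕ) :
    Integrable (fun x : ℝ =>
      x ^ k * (|x| ^ s * Real.exp (-(c * x ^ 6 + t * (x ^ 4 - x ^ 2))))) := by
  obtain ⟨C, hC⟩ := exists_exp_neg_sextic_le hc t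
  obtain ⟨N, hN⟩ := exists_nat_ge (k + s)
  have hint : Integrable (fun x : ℝ => C * (Real.exp (-1 * x ^ 2)
      + x ^ ((2 * N : ℕ) : ℝ) * Real.exp (-1 * x ^ 2))) :=
    ((integrable_exp_neg_mul_sq one_pos).add
      (integrable_rpow_mul_exp_neg_mul_sq one_pos
        (lt_of_lt_of_le (by norm_num) (Nat.cast_nonneg (2 * N))))).const_mul C
  refine hint.mono' ?_ (Filter.Eventually.of_forall fun x => ?_)
  · have : Continuous fun x : ℝ => |x| ^ s := continuous_abs.rpow_const fun _ => Or.inr hs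
    exact Continuous.aestronglyMeasurable (by fun_prop)
  · have hpow : |x| ^ k * |x| ^ s ≤ 1 + x ^ (2 * N) := by
      have h0 : 0 ≤ x ^ (2 * N) := by rw [pow_mul]; positivity
      rcases le_total |x| 1 with h | h
      · have h1 : |x| ^ k ≤ 1 := pow_le_one₀ (abs_nonneg x) h
        have h2 : |x| ^ s ≤ 1 := Real.rpow_le_one (abs_nonneg x) h hs
        have := mul_le_one₀ h1 (by positivity) h2
        linarith
      · have hx : 0 < |x| := by linarith
        have e : x ^ (2 * N) = |x| ^ ((2 * N : ℕ) : ℝ) := by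
          rw [Real.rpow_natCast, pow_mul, pow_mul, sq_abs]
        rw [e, ← Real.rpow_natCast |x| k, ← Real.rpow_add hx]
        have : |x| ^ ((k : ℝ) + s) ≤ |x| ^ ((2 * N : ℕ) : ℝ) := by
          apply Real.rpow_le_rpow_of_exponent_le h
          push_cast
          have : (0 : ℝ) ≤ N := Nat.cast_nonneg N
          linarith
        linarith
    rw [Real.rpow_natCast, norm_mul, norm_mul, norm_pow, Real.norm_eq_abs, Real.norm_eq_abs,
      Real.norm_eq_abs, Real.abs_exp, abs_of_nonneg (Real.rpow_nonneg (abs_nonneg x) s)]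
    calc |x| ^ k * (|x| ^ s * Real.exp (-(c * x ^ 6 + t * (x ^ 4 - x ^ 2))))
        = (|x| ^ k * |x| ^ s) * Real.exp (-(c * x ^ 6 + t * (x ^ 4 - x ^ 2))) := by ring
      _ ≤ (1 + x ^ (2 * N)) * (C * Real.exp (-1 * x ^ 2)) := by
          gcongr
          · exact le_trans (by positivity) hpow
          · exact hC x
      _ = C * (Real.exp (-1 * x ^ 2) + x ^ (2 * N) * Real.exp (-1 * x ^ 2)) := by ring

theorem integrable_eval_mul_abs_rpow_mul_exp {c : ℝ} (hc : 0 < c) (t : ℝ) {s : ℝ} (hs : 0 ≤ s)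
    (p : ℝ[X]) :
    Integrable (fun x : ℝ =>
      p.eval x * (|x| ^ s * Real.exp (-(c * x ^ 6 + t * (x ^ 4 - x ^ 2))))) := by
  induction p using Polynomial.induction_on' with
  | add p q hp hq =>
    refine (hp.add hq).congr (Filter.Eventually.of_forall fun x => ?_)
    simp only [Pi.add_apply, eval_add]
    ring
  | monomial n a =>
    refine ((integrable_pow_mul_abs_rpow_mul_exp hc t hs n).const_mul a).congr
      (Filter.Eventually.of_forall fun x => ?_)
    simp only [eval_monomial]
    ring

variable {c σ : ℝ} (t : ℝ)

theorem integrable_eval_mul_weight (hc : 0 < c) (hσ : 0 < σ) (p : ℝ[X]) :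
    Integrable fun x : ℝ => p.eval x * weight c t σ x :=
  integrable_eval_mul_abs_rpow_mul_exp hc t (by linarith) p

/-- Dividing by `x` lowers the exponent only to `2σ`, which is still nonnegative; hence `W_σ/x` is
dominated by a weight already treated. At the origin both sides are zero because `0⁻¹ = 0` and `sign
0 = 0`. -/
theorem inv_mul_weight (x : ℝ) :
    x⁻¹ * weight c t σ x =
      SignType.sign x * (|x| ^ (2 * σ) * Real.exp (-(c * x ^ 6 + t * (x ^ 4 - x ^ 2)))) := by
  rcases eq_or_ne x 0 with rfl | hx
  · simp
  · have hx' : 0 < |x| := abs_pos.mpr hx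
    rw [weight, Real.rpow_add hx', Real.rpow_one]
    have : x⁻¹ * |x| = SignType.sign x := by
      rw [← sign_mul_abs x, abs_mul, abs_abs]
      rcases lt_or_gt_of_ne hx with h | h
      · simp [sign_neg h, hx]
      · simp [sign_pos h, hx]
    rw [← this]
    ring

theorem integrable_eval_div_mul_weight (hc : 0 < c) (hσ : 0 < σ) (p : ℝ[X]) :
    Integrable fun x : ℝ => p.eval x * (x⁻¹ * weight c t σ x) := by
  refine (integrable_eval_mul_abs_rpow_mul_exp hc t (s := 2 * σ) (by linarith) p).mono ?_
    (Filter.Eventually.of_forall fun x => ?_)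
  · refine Measurable.aestronglyMeasurable ?_
    unfold weight
    fun_prop
  · rw [inv_mul_weight t, norm_mul, norm_mul, norm_mul]
    have : ‖((SignType.sign x : SignType) : ℝ)‖ ≤ 1 := by
      rcases lt_trichotomy x 0 with h | h | h
      · simp [sign_neg h]
      · simp [h]
      · simp [sign_pos h]
    rw [norm_mul, norm_mul]
    exact mul_le_mul_of_nonneg_left (mul_le_of_le_one_left (by positivity) this) (norm_nonneg _)

theorem weight_neg (c t σ x : ℝ) : weight c t σ (-x) = weight c t σ x := by
  simp only [weight, abs_neg]
  congr 3
  ring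

theorem weight_pos (c t σ : ℝ) {x : ℝ} (hx : x ≠ 0) : 0 < weight c t σ x := by
  have : 0 < |x| := abs_pos.mpr hx
  unfold weight
  positivity

theorem weight_nonneg (c t σ x : ℝ) : 0 ≤ weight c t σ x := by
  unfold weight
  positivity

theorem continuous_weight (c t : ℝ) (hσ : 0 < σ) : Continuous (weight c t σ) := by
  have : Continuous fun x : ℝ => |x| ^ (2 * σ + 1) :=
    continuous_abs.rpow_const fun _ => Or.inr (by linarith)
  unfold weight
  fun_prop

/-- The polynomial part `6cx^5 + t(4x^3 - 2x)` of the derivative of the potential. -/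
def potentialPoly (c t : ℝ) : ℝ[X] := C (6 * c) * X ^ 5 + C t * (C 4 * X ^ 3 - C 2 * X)

theorem eval_potentialPoly (c t x : ℝ) :
    (potentialPoly c t).eval x = 6 * c * x ^ 5 + t * (4 * x ^ 3 - 2 * x) := by
  simp [potentialPoly]

/-- The origin is included, since the exponent `2σ + 1` exceeds `1`. Integration by parts can
therefore run over the whole line without cutting at `0`. -/
theorem hasDerivAt_weight (c t : ℝ) (hσ : 0 < σ) (x : ℝ) :
    HasDerivAt (weight c t σ) ((2 * σ + 1) * (x⁻¹ * weight c t σ x)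
      - (potentialPoly c t).eval x * weight c t σ x) x := by
  have h1 : HasDerivAt (fun y : ℝ => -(c * y ^ 6 + t * (y ^ 4 - y ^ 2)))
      (-(potentialPoly c t).eval x) x := by
    rw [eval_potentialPoly]
    have := (((hasDerivAt_pow 6 x).const_mul c).add
      (((hasDerivAt_pow 4 x).sub (hasDerivAt_pow 2 x)).const_mul t)).neg
    refine this.congr_deriv ?_
    push_cast
    ring
  have h2 := (hasDerivAt_abs_rpow x (p := 2 * σ + 1) (by linarith)).mul h1.exp
  refine h2.congr_deriv ?_
  have key : x⁻¹ * |x| ^ (2 * σ + 1) = |x| ^ (2 * σ + 1 - 2) * x := by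
    rcases eq_or_ne x 0 with rfl | hx
    · simp
    · have hx' : 0 < |x| := abs_pos.mpr hx
      rw [Real.rpow_sub hx', Real.rpow_two, sq_abs]
      field_simp
  simp only [weight]
  rw [← mul_assoc x⁻¹, key]
  ring

theorem deriv_v (c t : ℝ) (hσ : 0 < σ) {x : ℝ} (hx : x ≠ 0) :
    deriv (v c t σ) x = (potentialPoly c t).eval x - (2 * σ + 1) / x := by
  have hw := (weight_pos c t σ hx).ne'
  have := ((hasDerivAt_weight c t hσ x).log hw).neg
  rw [show v c t σ = -fun y => Real.log (weight c t σ y) from rfl, this.deriv]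
  field_simp
  ring

/-! ### The moment functionals -/

/-- The linear functional `p ↦ ∫ p W_σ dx`. -/
def moment (hc : 0 < c) (hσ : 0 < σ) : ℝ[X] →ₗ[ℝ] ℝ where
  toFun p := ∫ x : ℝ, p.eval x * weight c t σ x
  map_add' p q := by
    rw [← integral_add (integrable_eval_mul_weight t hc hσ p)
      (integrable_eval_mul_weight t hc hσ q)]
    simp only [eval_add, add_mul]
  map_smul' a p := by
    simp only [eval_smul, smul_eq_mul, mul_assoc, RingHom.id_apply]
    rw [integral_const_mul]

/-- The linear functional `p ↦ ∫ p W_σ / x dx`. -/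
def invMoment (hc : 0 < c) (hσ : 0 < σ) : ℝ[X] →ₗ[ℝ] ℝ where
  toFun p := ∫ x : ℝ, p.eval x * (x⁻¹ * weight c t σ x)
  map_add' p q := by
    rw [← integral_add (integrable_eval_div_mul_weight t hc hσ p)
      (integrable_eval_div_mul_weight t hc hσ q)]
    simp only [eval_add, add_mul]
  map_smul' a p := by
    simp only [eval_smul, smul_eq_mul, mul_assoc, RingHom.id_apply]
    rw [integral_const_mul]

variable (hc : 0 < c) (hσ : 0 < σ)

theorem moment_apply (p : ℝ[X]) : moment t hc hσ p = ∫ x : ℝ, p.eval x * weight c t σ x := rfl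

theorem invMoment_apply (p : ℝ[X]) :
    invMoment t hc hσ p = ∫ x : ℝ, p.eval x * (x⁻¹ * weight c t σ x) := rfl

theorem pairing_eq_moment (p q : ℝ[X]) : pairing c t σ p q = moment t hc hσ (p * q) := by
  simp only [pairing, moment_apply, eval_mul]

theorem invMoment_X_mul (p : ℝ[X]) : invMoment t hc hσ (X * p) = moment t hc hσ p := by
  rw [invMoment_apply, moment_apply]
  refine integral_congr_ae ?_
  filter_upwards [compl_mem_ae_iff.mpr (measure_singleton (0 : ℝ))] with x hx
  have hx : x ≠ 0 := hx
  simp only [eval_mul, eval_X]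
  field_simp

theorem moment_comp_neg_X (p : ℝ[X]) : moment t hc hσ (p.comp (-X)) = moment t hc hσ p := by
  rw [moment_apply, moment_apply, ← integral_neg_eq_self]
  simp [weight_neg]

theorem invMoment_comp_neg_X (p : ℝ[X]) :
    invMoment t hc hσ (p.comp (-X)) = -invMoment t hc hσ p := by
  rw [invMoment_apply, invMoment_apply, ← integral_neg_eq_self, ← integral_neg]
  simp [weight_neg]

theorem moment_eq_zero_of_odd {p : ℝ[X]} (hp : p.comp (-X) = -p) : moment t hc hσ p = 0 := by
  have := moment_comp_neg_X t hc hσ p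
  rw [hp, map_neg] at this
  linarith

theorem invMoment_eq_zero_of_even {p : ℝ[X]} (hp : p.comp (-X) = p) :
    invMoment t hc hσ p = 0 := by
  have := invMoment_comp_neg_X t hc hσ p
  rw [hp] at this
  linarith

theorem moment_sq_pos {p : ℝ[X]} (hp : p ≠ 0) : 0 < moment t hc hσ (p * p) := by
  obtain ⟨x, hx0, hx⟩ : ∃ x : ℝ, x ≠ 0 ∧ p.eval x ≠ 0 := by
    by_contra! h
    -- The weight vanishes at `0`, so a nonroot away from the origin is needed; the factor `X` makes
    -- the value of `p` at `0` irrelevant.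
    have : X * p = 0 := Polynomial.funext fun x => by
      rcases eq_or_ne x 0 with rfl | hx
      · simp
      · simp [h x hx]
    simp [hp] at this
  rw [moment_apply]
  refine integral_pos_of_integrable_nonneg_nonzero (x := x) ?_
    (integrable_eval_mul_weight t hc hσ _) (fun y => ?_) ?_
  · exact (p * p).continuous.mul (continuous_weight c t hσ)
  · rw [eval_mul]
    exact mul_nonneg (mul_self_nonneg _) (weight_nonneg c t σ y)
  · rw [eval_mul]
    exact mul_ne_zero (mul_ne_zero hx hx) (weight_pos c t σ hx0).ne'

/-- Integration by parts against the weight. -/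
theorem moment_derivative (p : ℝ[X]) :
    moment t hc hσ (derivative p) =
      moment t hc hσ (potentialPoly c t * p) - (2 * σ + 1) * invMoment t hc hσ p := by
  have h1 := integrable_eval_mul_weight t hc hσ (derivative p - potentialPoly c t * p)
  have h2 := (integrable_eval_div_mul_weight t hc hσ p).const_mul (2 * σ + 1)
  have := integral_eq_zero_of_hasDerivAt_of_integrable
    (f := fun x => p.eval x * weight c t σ x)
    (f' := fun x => (derivative p - potentialPoly c t * p).eval x * weight c t σ x
      + (2 * σ + 1) * (p.eval x * (x⁻¹ * weight c t σ x)))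
    (fun x => by
      refine ((p.hasDerivAt x).mul (hasDerivAt_weight c t hσ x)).congr_deriv ?_
      simp only [eval_sub, eval_mul]
      ring)
    (h1.add h2) (integrable_eval_mul_weight t hc hσ p)
  rw [integral_add h1 h2, integral_const_mul, ← moment_apply t hc hσ, ← invMoment_apply t hc hσ,
    map_sub] at this
  linarith

/-! ### The ladder functional -/

/-- The polynomial `τ ↦ (Q(x) - Q(τ)) / (x - τ)` for `Q = potentialPoly c t`. -/
def dividedPotential (c t x : ℝ) : ℝ[X] :=
  C (6 * c) * (C (x ^ 4) + C (x ^ 3) * X + C (x ^ 2) * X ^ 2 + C x * X ^ 3 + X ^ 4)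
    + C t * (C 4 * (C (x ^ 2) + C x * X + X ^ 2) - C 2)

theorem sub_mul_dividedPotential (c t x : ℝ) :
    (C x - X) * dividedPotential c t x = C ((potentialPoly c t).eval x) - potentialPoly c t := by
  rw [eval_potentialPoly]
  simp only [dividedPotential, potentialPoly, map_add, map_sub, map_mul, map_pow]
  ring

/-- The functional `f ↦ ∫ (v'(x) - v'(τ)) / (x - τ) f(τ) W_σ(τ) dτ`. -/
def ladder (x : ℝ) : ℝ[X] →ₗ[ℝ] ℝ :=
  (moment t hc hσ) ∘ₗ (LinearMap.mulLeft ℝ (dividedPotential c t x))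
    + ((2 * σ + 1) / x) • invMoment t hc hσ

theorem ladder_apply (x : ℝ) (f : ℝ[X]) :
    ladder t hc hσ x f = moment t hc hσ (dividedPotential c t x * f)
      + (2 * σ + 1) / x * invMoment t hc hσ f := rfl

/-- The singular part `-(2σ+1)/x` of `v'` has divided difference `(2σ+1)/(xτ)`, whence the second
summand of `ladder`. The points `τ = 0` and `τ = x`, where the integrand takes default values, form
a null set. -/
theorem integral_eq_ladder {x : ℝ} (hx : x ≠ 0) (f : ℝ[X]) :
    ∫ τ : ℝ, (deriv (v c t σ) x - deriv (v c t σ) τ) / (x - τ) * f.eval τ * weight c t σ τ =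
      ladder t hc hσ x f := by
  rw [ladder_apply, moment_apply, invMoment_apply, ← integral_const_mul,
    ← integral_add (integrable_eval_mul_weight t hc hσ _)
      ((integrable_eval_div_mul_weight t hc hσ f).const_mul _)]
  refine integral_congr_ae ?_
  filter_upwards [compl_mem_ae_iff.mpr (measure_singleton (0 : ℝ)),
    compl_mem_ae_iff.mpr (measure_singleton x)] with τ h0 h1
  have h0 : τ ≠ 0 := h0
  have h1 : x - τ ≠ 0 := sub_ne_zero.mpr (Ne.symm h1)
  have key := congrArg (eval τ) (sub_mul_dividedPotential c t x)
  simp only [eval_mul, eval_sub, eval_C, eval_X] at key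
  rw [deriv_v c t hσ hx, deriv_v c t hσ h0, eval_mul]
  have : (potentialPoly c t).eval x =
      (potentialPoly c t).eval τ + (x - τ) * (dividedPotential c t x).eval τ := by linarith
  rw [this]
  field_simp
  ring

/-- The factor `x - τ` cancels the denominator and leaves `v'(x) ∫ f W_σ - ∫ v' f W_σ`; integration
by parts turns the last integral into `∫ f' W_σ`. -/
theorem ladder_sub_mul {x : ℝ} (hx : x ≠ 0) (f : ℝ[X]) :
    ladder t hc hσ x ((C x - X) * f) =
      deriv (v c t σ) x * moment t hc hσ f - moment t hc hσ (derivative f) := by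
  have e1 : dividedPotential c t x * ((C x - X) * f) =
      (potentialPoly c t).eval x • f - potentialPoly c t * f := by
    rw [smul_eq_C_mul, ← sub_mul, ← sub_mul_dividedPotential]
    ring
  have e2 : (C x - X) * f = x • f - X * f := by
    rw [smul_eq_C_mul, sub_mul]
  rw [ladder_apply, e1, e2, map_sub, map_sub, map_smul, map_smul, invMoment_X_mul,
    moment_derivative, deriv_v c t hσ hx]
  simp only [smul_eq_mul]
  field_simp
  ring

/-! ### Orthogonality -/

theorem monicOP_eq (c t σ : ℝ) (n : ℕ) :
    monicOP c t σ n = X ^ n - ∑ k ∈ Finset.range n,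
      C (pairing c t σ (X ^ n) (monicOP c t σ k) /
        pairing c t σ (monicOP c t σ k) (monicOP c t σ k)) * monicOP c t σ k := by
  rw [monicOP, Finset.sum_range]

theorem monic_natDegree_monicOP (c t σ : ℝ) (n : ℕ) :
    (monicOP c t σ n).Monic ∧ (monicOP c t σ n).natDegree = n := by
  induction n using Nat.strong_induction_on with
  | _ n ih =>
    have hdeg : (∑ k ∈ Finset.range n,
        C (pairing c t σ (X ^ n) (monicOP c t σ k) /
          pairing c t σ (monicOP c t σ k) (monicOP c t σ k)) * monicOP c t σ k).degree
          < (n : WithBot ℕ) := by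
      rw [← mem_degreeLT]
      refine Submodule.sum_mem _ fun k hk => ?_
      have hk := Finset.mem_range.mp hk
      rw [← smul_eq_C_mul]
      refine Submodule.smul_mem _ _ (mem_degreeLT.mpr ?_)
      exact lt_of_le_of_lt degree_le_natDegree (by rw [(ih k hk).2]; exact_mod_cast hk)
    rw [monicOP_eq]
    refine ⟨monic_X_pow_sub hdeg, ?_⟩
    refine natDegree_eq_of_degree_eq_some ?_
    rw [degree_sub_eq_left_of_degree_lt (by rwa [degree_X_pow]), degree_X_pow]

theorem monicOP_monic (c t σ : ℝ) (n : ℕ) : (monicOP c t σ n).Monic :=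
  (monic_natDegree_monicOP c t σ n).1

theorem natDegree_monicOP (c t σ : ℝ) (n : ℕ) : (monicOP c t σ n).natDegree = n :=
  (monic_natDegree_monicOP c t σ n).2

theorem degree_monicOP (c t σ : ℝ) (n : ℕ) : (monicOP c t σ n).degree = n := by
  rw [degree_eq_natDegree (monicOP_monic c t σ n).ne_zero, natDegree_monicOP]

theorem moment_monicOP_sq_pos (n : ℕ) :
    0 < moment t hc hσ (monicOP c t σ n * monicOP c t σ n) :=
  moment_sq_pos t hc hσ (monicOP_monic c t σ n).ne_zero

theorem moment_monicOP_mul_of_lt (n : ℕ) : ∀ j < n,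
    moment t hc hσ (monicOP c t σ n * monicOP c t σ j) = 0 := by
  induction n using Nat.strong_induction_on with
  | _ n ih =>
    intro j hj
    have hother : ∀ k ∈ Finset.range n, k ≠ j →
        moment t hc hσ (monicOP c t σ k * monicOP c t σ j) = 0 := by
      intro k hk hkj
      rcases lt_or_gt_of_ne hkj with h | h
      · rw [mul_comm]
        exact ih j hj k h
      · exact ih k (Finset.mem_range.mp hk) j h
    rw [monicOP_eq, sub_mul, Finset.sum_mul, map_sub, map_sum]
    simp only [← smul_eq_C_mul, smul_mul_assoc, map_smul, smul_eq_mul]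
    rw [Finset.sum_eq_single j (fun k hk hkj => by rw [hother k hk hkj, mul_zero])
      (fun h => absurd (Finset.mem_range.mpr hj) h), pairing_eq_moment t hc hσ,
      pairing_eq_moment t hc hσ, div_mul_cancel₀ _ (moment_monicOP_sq_pos t hc hσ j).ne', sub_self]

theorem moment_monicOP_mul_of_ne {m n : ℕ} (h : m ≠ n) :
    moment t hc hσ (monicOP c t σ m * monicOP c t σ n) = 0 := by
  rcases lt_or_gt_of_ne h with h | h
  · rw [mul_comm]
    exact moment_monicOP_mul_of_lt t hc hσ n m h
  · exact moment_monicOP_mul_of_lt t hc hσ m n h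

include hc hσ in
theorem monicOP_comp_neg_X (n : ℕ) :
    (monicOP c t σ n).comp (-X) = (-1) ^ n * monicOP c t σ n := by
  induction n using Nat.strong_induction_on with
  | _ n ih =>
    rw [monicOP_eq, sub_comp, mul_sub, sum_comp, Finset.mul_sum]
    congr 1
    · rw [X_pow_comp, neg_pow]
    · refine Finset.sum_congr rfl fun k hk => ?_
      have ih := ih k (Finset.mem_range.mp hk)
      rw [mul_comp, C_comp, ih]
      -- If `n + k` is even, the signs of the two terms agree; if it is odd, the Gram-Schmidt
      -- coefficient is the integral of an odd function.
      rcases Nat.even_or_odd (n + k) with he | ho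
      · have : (-1 : ℝ[X]) ^ n = (-1) ^ k := by
          rcases Nat.even_or_odd k with hk | hk
          · rw [hk.neg_one_pow, ((Nat.even_add.mp he).mpr hk).neg_one_pow]
          · rw [hk.neg_one_pow, Odd.neg_one_pow]
            rw [← Nat.not_even_iff_odd] at hk ⊢
            rwa [Nat.even_add.mp he]
        rw [this]
        ring
      · have : pairing c t σ (X ^ n) (monicOP c t σ k) = 0 := by
          rw [pairing_eq_moment t hc hσ]
          refine moment_eq_zero_of_odd t hc hσ ?_
          rw [mul_comp, X_pow_comp, ih, neg_pow]
          calc (-1) ^ n * X ^ n * ((-1) ^ k * monicOP c t σ k)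
              = (-1) ^ (n + k) * (X ^ n * monicOP c t σ k) := by ring
            _ = _ := by rw [ho.neg_one_pow]; ring
        simp [this]

/-- A linear functional vanishing on `S_0, …, S_{n-1}` vanishes on all polynomials of degree
less than `n`. -/
theorem linearMap_eq_zero_of_monicOP {φ : ℝ[X] →ₗ[ℝ] ℝ} {n : ℕ}
    (hφ : ∀ k < n, φ (monicOP c t σ k) = 0) {q : ℝ[X]} (hq : q.degree < (n : WithBot ℕ)) :
    φ q = 0 := by
  induction n generalizing q with
  | zero =>
    rw [degree_lt_iff_coeff_zero] at hq
    have : q = 0 := by ext m; simpa using hq m (Nat.zero_le m)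
    rw [this, map_zero]
  | succ n ih =>
    -- Since `S_n` is monic, subtracting this multiple removes the coefficient of degree `n`.
    have hr : (q - q.coeff n • monicOP c t σ n).degree < (n : WithBot ℕ) := by
      rw [degree_lt_iff_coeff_zero] at hq ⊢
      intro m hm
      rw [coeff_sub, coeff_smul, smul_eq_mul]
      rcases hm.eq_or_lt with rfl | h
      · have : (monicOP c t σ n).coeff n = 1 := by
          have := (monicOP_monic c t σ n).coeff_natDegree
          rwa [natDegree_monicOP] at this
        rw [this]
        ring
      · rw [hq m h, coeff_eq_zero_of_natDegree_lt (p := monicOP c t σ n) (by rwa [natDegree_monicOP])]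
        ring
    have := ih (fun k hk => hφ k (by omega)) hr
    rwa [map_sub, map_smul, hφ n n.lt_succ_self, smul_zero, sub_zero] at this

theorem eq_zero_of_moment_monicOP {n : ℕ} {p : ℝ[X]} (hp : p.degree < (n : WithBot ℕ))
    (h : ∀ k < n, moment t hc hσ (p * monicOP c t σ k) = 0) : p = 0 := by
  by_contra h0
  have := linearMap_eq_zero_of_monicOP t (φ := moment t hc hσ ∘ₗ LinearMap.mulLeft ℝ p)
    (fun k hk => h k hk) hp
  exact (moment_sq_pos t hc hσ h0).ne' this

theorem moment_mul_monicOP_eq_zero {n : ℕ} {p : ℝ[X]} (hp : p.degree < (n : WithBot ℕ)) :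
    moment t hc hσ (monicOP c t σ n * p) = 0 :=
  linearMap_eq_zero_of_monicOP t (φ := moment t hc hσ ∘ₗ LinearMap.mulLeft ℝ (monicOP c t σ n))
    (fun k hk => moment_monicOP_mul_of_lt t hc hσ n k hk) hp

/-! ### The integer-indexed sequence -/

theorem S_natCast (c t σ : ℝ) (n : ℕ) : S c t σ n = monicOP c t σ n := rfl

theorem S_natCast_add_one (c t σ : ℝ) (n : ℕ) : S c t σ (n + 1) = monicOP c t σ (n + 1) := rfl

theorem S_of_neg (c t σ : ℝ) {n : ℤ} (hn : n < 0) : S c t σ n = 0 := by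
  cases n with
  | ofNat n => exact absurd hn (by simp)
  | negSucc n => rfl

theorem S_zero (c t σ : ℝ) : S c t σ 0 = 1 := by
  have := S_natCast c t σ 0
  rw [monicOP_eq] at this
  simpa using this

theorem γ_of_nonpos (c t σ : ℝ) {n : ℤ} (hn : n ≤ 0) : γ c t σ n = 0 := if_pos hn

theorem moment_S_mul_S {m n : ℤ} (h : m ≠ n) :
    moment t hc hσ (S c t σ m * S c t σ n) = 0 := by
  rcases lt_or_ge m 0 with hm | hm
  · rw [S_of_neg c t σ hm, zero_mul, map_zero]
  rcases lt_or_ge n 0 with hn | hn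
  · rw [S_of_neg c t σ hn, mul_zero, map_zero]
  lift m to ℕ using hm
  lift n to ℕ using hn
  exact moment_monicOP_mul_of_ne t hc hσ (by exact_mod_cast h)

theorem normSq_eq (n : ℤ) : normSq c t σ n = moment t hc hσ (S c t σ n * S c t σ n) :=
  pairing_eq_moment t hc hσ _ _

include hc hσ in
theorem normSq_pos (n : ℕ) : 0 < normSq c t σ n := by
  rw [normSq_eq t hc hσ]
  exact moment_monicOP_sq_pos t hc hσ n

include hc hσ in
theorem S_comp_neg_X (n : ℤ) : (S c t σ n).comp (-X) = (-1) ^ n.natAbs * S c t σ n := by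
  rcases lt_or_ge n 0 with hn | hn
  · simp [S_of_neg c t σ hn]
  · lift n to ℕ using hn
    exact monicOP_comp_neg_X t hc hσ n

include hc hσ in
theorem S_sq_comp_neg_X (n : ℤ) :
    (S c t σ n * S c t σ n).comp (-X) = S c t σ n * S c t σ n := by
  rw [mul_comp, S_comp_neg_X t hc hσ]
  have : (-1 : ℝ[X]) ^ n.natAbs * (-1) ^ n.natAbs = 1 := by
    rw [← mul_pow]; simp
  linear_combination (S c t σ n * S c t σ n) * this

include hc hσ in
theorem S_succ_mul_S_comp_neg_X (n : ℕ) :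
    (S c t σ (n + 1) * S c t σ n).comp (-X) = -(S c t σ (n + 1) * S c t σ n) := by
  rw [mul_comp, S_natCast_add_one, S_natCast, monicOP_comp_neg_X t hc hσ,
    monicOP_comp_neg_X t hc hσ]
  have : (-1 : ℝ[X]) ^ n * (-1) ^ n = 1 := by
    rw [← mul_pow]; simp
  linear_combination (-monicOP c t σ (n + 1) * monicOP c t σ n) * this

theorem moment_odd_pow_mul_S_sq {k : ℕ} (hk : Odd k) (n : ℤ) :
    moment t hc hσ (X ^ k * (S c t σ n * S c t σ n)) = 0 := by
  refine moment_eq_zero_of_odd t hc hσ ?_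
  rw [mul_comp, S_sq_comp_neg_X t hc hσ, X_pow_comp, hk.neg_pow, neg_mul]

theorem moment_even_pow_mul_S_succ_mul_S {k : ℕ} (hk : Even k) (n : ℕ) :
    moment t hc hσ (X ^ k * (S c t σ (n + 1) * S c t σ n)) = 0 := by
  refine moment_eq_zero_of_odd t hc hσ ?_
  rw [mul_comp, S_succ_mul_S_comp_neg_X t hc hσ, X_pow_comp, hk.neg_pow, mul_neg]

theorem invMoment_S_sq (n : ℤ) : invMoment t hc hσ (S c t σ n * S c t σ n) = 0 :=
  invMoment_eq_zero_of_even t hc hσ (S_sq_comp_neg_X t hc hσ n)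

/-! ### The three-term recurrence -/

theorem γ_succ_mul_normSq (n : ℕ) :
    γ c t σ (n + 1) * normSq c t σ n = moment t hc hσ (X * S c t σ (n + 1) * S c t σ n) := by
  rw [γ, if_neg (by omega), add_sub_cancel_right,
    div_mul_cancel₀ _ (normSq_pos t hc hσ n).ne', pairing_eq_moment t hc hσ]

-- The difference of the two sides has degree at most `n`, because the leading terms cancel, and it
-- is orthogonal to `S_0, …, S_n`; so it is orthogonal to itself.
include hc hσ in
theorem S_succ (n : ℕ) :
    S c t σ (n + 1) = X * S c t σ n - C (γ c t σ n) * S c t σ (n - 1) := by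
  rw [← sub_eq_zero]
  have hX : (X * monicOP c t σ n).degree = ((n + 1 : ℕ) : WithBot ℕ) := by
    rw [degree_mul, degree_monicOP, degree_X, add_comm]
    rfl
  refine eq_zero_of_moment_monicOP t hc hσ (n := n + 1) ?_ ?_
  · have e : S c t σ (n + 1) - (X * S c t σ n - C (γ c t σ n) * S c t σ (n - 1)) =
        (S c t σ (n + 1) - X * S c t σ n) + γ c t σ n • S c t σ (n - 1) := by
      rw [smul_eq_C_mul]; ring
    rw [e, ← mem_degreeLT]
    refine Submodule.add_mem _ (mem_degreeLT.mpr ?_) (Submodule.smul_mem _ _ (mem_degreeLT.mpr ?_))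
    · rw [S_natCast_add_one, S_natCast]
      have := degree_sub_lt_left (p := monicOP c t σ (n + 1)) (q := X * monicOP c t σ n)
        (by rw [degree_monicOP, hX]) (monicOP_monic c t σ _).ne_zero
        (by rw [(monicOP_monic c t σ _).leadingCoeff,
          (monic_X.mul (monicOP_monic c t σ _)).leadingCoeff])
      rwa [degree_monicOP] at this
    · cases n with
      | zero => simp [S_of_neg]
      | succ n =>
        rw [show ((n + 1 : ℕ) : ℤ) - 1 = (n : ℤ) by push_cast; ring, S_natCast, degree_monicOP]
        exact_mod_cast (by omega : n < n + 1 + 1)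
  · intro k hk
    have hswap : moment t hc hσ (X * S c t σ n * monicOP c t σ k) =
        moment t hc hσ (monicOP c t σ n * (X * monicOP c t σ k)) := by
      rw [S_natCast]; congr 1; ring
    have e : (S c t σ (n + 1) - (X * S c t σ n - C (γ c t σ n) * S c t σ (n - 1)))
        * monicOP c t σ k = S c t σ (n + 1) * S c t σ k - X * S c t σ n * monicOP c t σ k
          + γ c t σ n • (S c t σ (n - 1) * S c t σ k) := by
      rw [smul_eq_C_mul, S_natCast c t σ k]; ring
    rw [e, map_add, map_sub, map_smul, smul_eq_mul, moment_S_mul_S t hc hσ (by omega), zero_sub]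
    -- For `k + 1 < n` the degree of `X S_k` is too small to meet `S_n`; for `k + 1 = n` the
    -- definition of `γ_n` makes the terms cancel; the remaining case is `k = n`, settled by parity.
    rcases Nat.lt_trichotomy (k + 1) n with h | h | h
    · rw [moment_S_mul_S t hc hσ (by omega), hswap, moment_mul_monicOP_eq_zero, mul_zero,
        neg_zero, add_zero]
      rw [degree_mul, degree_monicOP, degree_X]
      exact_mod_cast (by omega : 1 + k < n)
    · subst h
      rw [show ((k + 1 : ℕ) : ℤ) - 1 = (k : ℤ) by push_cast; ring, ← normSq_eq t hc hσ,
        Nat.cast_add_one, γ_succ_mul_normSq t hc hσ, S_natCast c t σ k, neg_add_cancel]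
    · obtain rfl : k = n := by omega
      have := moment_odd_pow_mul_S_sq t hc hσ (k := 1) (by decide) k
      rw [pow_one, ← mul_assoc] at this
      rw [moment_S_mul_S t hc hσ (by omega), ← S_natCast, this, mul_zero, neg_zero, add_zero]

include hc hσ in
theorem X_mul_S (n : ℕ) :
    X * S c t σ n = S c t σ (n + 1) + C (γ c t σ n) * S c t σ (n - 1) := by
  rw [S_succ t hc hσ]; ring

include hc hσ in
theorem X_mul_S_succ (n : ℕ) :
    X * S c t σ (n + 1) = S c t σ (n + 2) + C (γ c t σ (n + 1)) * S c t σ n := by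
  have := X_mul_S t hc hσ (n + 1)
  push_cast at this
  rwa [add_sub_cancel_right, add_assoc, one_add_one_eq_two] at this

include hc hσ in
theorem normSq_succ (n : ℕ) : normSq c t σ (n + 1) = γ c t σ (n + 1) * normSq c t σ n := by
  rw [γ_succ_mul_normSq t hc hσ, normSq_eq t hc hσ]
  have e : X * S c t σ (n + 1) * S c t σ n = S c t σ (n + 1) * S c t σ (n + 1)
      + γ c t σ n • (S c t σ (n + 1) * S c t σ (n - 1)) := by
    rw [smul_eq_C_mul, mul_right_comm, X_mul_S t hc hσ]; ring
  rw [e, map_add, map_smul, moment_S_mul_S t hc hσ (by omega : (n : ℤ) + 1 ≠ n - 1), smul_zero, add_zero]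

-- The extra factor `γ_n` makes `Γ_n = γ_n Γ_{n-1}` usable at `n = 0`, where that identity itself
-- fails because `Γ_{-1} = 0 < Γ_0`.
include hc hσ in
theorem γ_sq_mul_normSq (n : ℕ) :
    γ c t σ n ^ 2 * normSq c t σ (n - 1) = γ c t σ n * normSq c t σ n := by
  cases n with
  | zero => simp [γ_of_nonpos]
  | succ n =>
    rw [Nat.cast_add_one, add_sub_cancel_right, normSq_succ t hc hσ]
    ring

-- Without the factor `γ_n` the recurrence for `S_{n-1}` would fail at `n = 0`, where it would read
-- `0 = S_0`.
include hc hσ in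
theorem γ_mul_X_mul_S_pred (n : ℕ) :
    C (γ c t σ n) * (X * S c t σ (n - 1)) =
      C (γ c t σ n) * (S c t σ n + C (γ c t σ (n - 1)) * S c t σ (n - 2)) := by
  cases n with
  | zero => simp [γ_of_nonpos]
  | succ n =>
    rw [Nat.cast_add_one, add_sub_cancel_right, X_mul_S t hc hσ,
      show (n : ℤ) + 1 - 2 = n - 1 by ring]

include hc hσ in
theorem X_sq_mul_S (n : ℕ) :
    X ^ 2 * S c t σ n = S c t σ (n + 2) + C (γ c t σ n + γ c t σ (n + 1)) * S c t σ n
      + C (γ c t σ n * γ c t σ (n - 1)) * S c t σ (n - 2) := by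
  rw [C_add, C_mul]
  linear_combination X * X_mul_S t hc hσ n + X_mul_S_succ t hc hσ n
    + γ_mul_X_mul_S_pred t hc hσ n

/-! ### Moments of products of consecutive polynomials -/

theorem moment_X_sq_mul_S_sq (n : ℕ) :
    moment t hc hσ (X ^ 2 * (S c t σ n * S c t σ n)) =
      (γ c t σ n + γ c t σ (n + 1)) * normSq c t σ n := by
  have e : X ^ 2 * (S c t σ n * S c t σ n) = S c t σ (n + 2) * S c t σ n
      + (γ c t σ n + γ c t σ (n + 1)) • (S c t σ n * S c t σ n)
      + (γ c t σ n * γ c t σ (n - 1)) • (S c t σ (n - 2) * S c t σ n) := by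
    rw [smul_eq_C_mul, smul_eq_C_mul, ← mul_assoc, X_sq_mul_S t hc hσ]; ring
  rw [e, map_add, map_add, map_smul, map_smul,
    moment_S_mul_S t hc hσ (by omega : (n : ℤ) + 2 ≠ n),
    moment_S_mul_S t hc hσ (by omega : (n : ℤ) - 2 ≠ n), ← normSq_eq, zero_add, smul_zero, add_zero, smul_eq_mul]

include hc hσ in
theorem γ_mul_γ_sq_mul_normSq (n : ℕ) :
    (γ c t σ n * γ c t σ (n - 1)) ^ 2 * normSq c t σ (n - 2) =
      γ c t σ n * γ c t σ (n - 1) * normSq c t σ n := by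
  cases n with
  | zero => simp [γ_of_nonpos]
  | succ n =>
    have := γ_sq_mul_normSq t hc hσ n
    rw [Nat.cast_add_one, add_sub_cancel_right, show (n : ℤ) + 1 - 2 = n - 1 by ring,
      normSq_succ t hc hσ]
    linear_combination γ c t σ (n + 1) ^ 2 * this

/-- Squaring the expansion of `X² S_n` leaves, by orthogonality, only the norms of `S_{n+2}`, `S_n`
and `S_{n-2}`; each is a product of `γ`'s times `Γ_n` once its coefficient is included. -/
theorem moment_X_pow_four_mul_S_sq (n : ℕ) :
    moment t hc hσ (X ^ 4 * (S c t σ n * S c t σ n)) =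
      (Ξ c t σ (n + 1) + Ξ c t σ n) * normSq c t σ n := by
  set a := γ c t σ n + γ c t σ (n + 1) with ha
  set b := γ c t σ n * γ c t σ (n - 1) with hb
  have e : X ^ 4 * (S c t σ n * S c t σ n) = S c t σ (n + 2) * S c t σ (n + 2)
      + a ^ 2 • (S c t σ n * S c t σ n) + b ^ 2 • (S c t σ (n - 2) * S c t σ (n - 2))
      + (2 * a) • (S c t σ (n + 2) * S c t σ n) + (2 * b) • (S c t σ (n + 2) * S c t σ (n - 2))
      + (2 * a * b) • (S c t σ n * S c t σ (n - 2)) := by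
    have h := X_sq_mul_S t hc hσ n
    rw [← ha, ← hb] at h
    calc X ^ 4 * (S c t σ n * S c t σ n) = (X ^ 2 * S c t σ n) * (X ^ 2 * S c t σ n) := by ring
      _ = _ := by
        rw [h]
        simp only [smul_eq_C_mul, map_mul, map_pow, map_ofNat]
        ring
  rw [e]
  simp only [map_add, map_smul, smul_eq_mul]
  rw [moment_S_mul_S t hc hσ (by omega : (n : ℤ) + 2 ≠ n),
    moment_S_mul_S t hc hσ (by omega : (n : ℤ) + 2 ≠ n - 2),
    moment_S_mul_S t hc hσ (by omega : (n : ℤ) ≠ n - 2), ← normSq_eq, ← normSq_eq, ← normSq_eq]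
  have h1 := γ_mul_γ_sq_mul_normSq t hc hσ n
  have h2 := normSq_succ t hc hσ n
  have h3 := normSq_succ t hc hσ (n + 1)
  rw [Nat.cast_add_one, show (n : ℤ) + 1 + 1 = n + 2 by ring] at h3
  rw [h3, h2]
  rw [← hb] at h1
  rw [h1]
  simp only [Ξ, add_sub_cancel_right, show (n : ℤ) + 1 + 1 = n + 2 by ring, ha, hb]
  ring

theorem moment_X_mul_S_succ_mul_S (n : ℕ) :
    moment t hc hσ (X * (S c t σ (n + 1) * S c t σ n)) = γ c t σ (n + 1) * normSq c t σ n := by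
  rw [γ_succ_mul_normSq t hc hσ, mul_assoc]

theorem moment_X_pow_three_mul_S_succ_mul_S (n : ℕ) :
    moment t hc hσ (X ^ 3 * (S c t σ (n + 1) * S c t σ n)) =
      Ξ c t σ (n + 1) * normSq c t σ n := by
  set a := γ c t σ n + γ c t σ (n + 1) with ha
  set b := γ c t σ n * γ c t σ (n - 1) with hb
  have e : X ^ 3 * (S c t σ (n + 1) * S c t σ n) =
      S c t σ (n + 2) * S c t σ (n + 2) + γ c t σ (n + 1) • (S c t σ (n + 2) * S c t σ n)
      + a • (S c t σ (n + 2) * S c t σ n) + (a * γ c t σ (n + 1)) • (S c t σ n * S c t σ n)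
      + b • (S c t σ (n + 2) * S c t σ (n - 2))
      + (b * γ c t σ (n + 1)) • (S c t σ n * S c t σ (n - 2)) := by
    have h := X_sq_mul_S t hc hσ n
    rw [← ha, ← hb] at h
    calc X ^ 3 * (S c t σ (n + 1) * S c t σ n)
        = (X * S c t σ (n + 1)) * (X ^ 2 * S c t σ n) := by ring
      _ = _ := by
        rw [h, X_mul_S_succ t hc hσ]
        simp only [smul_eq_C_mul, map_mul]
        ring
  rw [e]
  simp only [map_add, map_smul, smul_eq_mul]
  rw [moment_S_mul_S t hc hσ (by omega : (n : ℤ) + 2 ≠ n),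
    moment_S_mul_S t hc hσ (by omega : (n : ℤ) + 2 ≠ n - 2),
    moment_S_mul_S t hc hσ (by omega : (n : ℤ) ≠ n - 2), ← normSq_eq, ← normSq_eq]
  have h2 := normSq_succ t hc hσ n
  have h3 := normSq_succ t hc hσ (n + 1)
  rw [Nat.cast_add_one, show (n : ℤ) + 1 + 1 = n + 2 by ring] at h3
  rw [h3, h2]
  simp only [Ξ, add_sub_cancel_right, show (n : ℤ) + 1 + 1 = n + 2 by ring, ha]
  ring

theorem Ω_add_one (n : ℤ) : Ω (n + 1) = 1 - Ω n := by
  rw [Ω, Ω, zpow_add_one₀ (by norm_num)]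
  ring

/-- Write `r_n` for `∫ S_n S_{n-1} W_σ/x` over `Γ_{n-1}`. Inserting the recurrence into `Γ_n = ∫ (x
S_n) S_n W_σ/x` gives `r_{n+1} = 1 - r_n` for `n ≥ 1`, with `r_1 = 1`, so the values alternate as
`Ω_n` does. -/
theorem invMoment_S_succ_mul_S (n : ℕ) :
    invMoment t hc hσ (S c t σ (n + 1) * S c t σ n) = Ω (n + 1) * normSq c t σ n := by
  have hmul : ∀ m : ℕ, invMoment t hc hσ (X * S c t σ m * S c t σ m) = normSq c t σ m := fun m => by
    rw [mul_assoc, invMoment_X_mul, ← normSq_eq]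
  induction n with
  | zero =>
    have h := hmul 0
    rw [X_mul_S t hc hσ, γ_of_nonpos c t σ (n := ((0 : ℕ) : ℤ)) (by simp), C_0, zero_mul,
      add_zero] at h
    rw [h, Ω_add_one]
    simp [Ω]
  | succ n ih =>
    have h := hmul (n + 1)
    rw [Nat.cast_add_one] at h ⊢
    have e : X * S c t σ (n + 1) * S c t σ (n + 1) =
        S c t σ (n + 1 + 1) * S c t σ (n + 1)
          + γ c t σ (n + 1) • (S c t σ (n + 1) * S c t σ n) := by
      rw [X_mul_S_succ t hc hσ, smul_eq_C_mul, add_assoc, one_add_one_eq_two]; ring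
    rw [e, map_add, map_smul, smul_eq_mul, ih] at h
    rw [Ω_add_one]
    linear_combination h + Ω (n + 1) * normSq_succ t hc hσ n

/-! ### The ladder functions -/

theorem normSq_mul_A {x : ℝ} (hx : x ≠ 0) (n : ℕ) :
    normSq c t σ n * A c t σ n x = ladder t hc hσ x (S c t σ n * S c t σ n) := by
  have := (normSq_pos t hc hσ n).ne'
  rw [A, ← integral_eq_ladder t hc hσ hx, one_div, mul_inv_cancel_left₀ this]
  simp only [eval_mul, sq]

theorem normSq_mul_B {x : ℝ} (hx : x ≠ 0) (n : ℕ) :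
    normSq c t σ n * B c t σ (n + 1) x = ladder t hc hσ x (S c t σ (n + 1) * S c t σ n) := by
  have := (normSq_pos t hc hσ n).ne'
  rw [B, add_sub_cancel_right, ← integral_eq_ladder t hc hσ hx, one_div, mul_inv_cancel_left₀ this]
  simp only [eval_mul]

theorem B_zero (c t σ x : ℝ) : B c t σ 0 x = 0 := by
  simp [B, S_of_neg]

theorem moment_dividedPotential_mul (x : ℝ) (f : ℝ[X]) :
    moment t hc hσ (dividedPotential c t x * f) =
      6 * c * (x ^ 4 * moment t hc hσ (X ^ 0 * f) + x ^ 3 * moment t hc hσ (X ^ 1 * f)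
        + x ^ 2 * moment t hc hσ (X ^ 2 * f) + x * moment t hc hσ (X ^ 3 * f)
        + moment t hc hσ (X ^ 4 * f))
      + t * (4 * (x ^ 2 * moment t hc hσ (X ^ 0 * f) + x * moment t hc hσ (X ^ 1 * f)
        + moment t hc hσ (X ^ 2 * f)) - 2 * moment t hc hσ (X ^ 0 * f)) := by
  -- The right side is folded back into a single moment, which reduces the claim to an identity of
  -- polynomials.
  simp only [← smul_eq_mul (a := (_ : ℝ)) (b := (_ : ℝ)), ← map_smul, ← map_add, ← map_sub]
  congr 1
  simp only [smul_eq_C_mul, smul_eq_mul, dividedPotential, map_mul, map_pow, map_ofNat]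
  ring

include hc hσ in
theorem A_eq_D {x : ℝ} (hx : x ≠ 0) (n : ℕ) : A c t σ n x = D c t σ n x := by
  have hN := (normSq_pos t hc hσ n).ne'
  refine mul_left_cancel₀ hN ?_
  rw [normSq_mul_A t hc hσ hx, ladder_apply, invMoment_S_sq, moment_dividedPotential_mul,
    moment_odd_pow_mul_S_sq t hc hσ (by decide : Odd 1),
    moment_odd_pow_mul_S_sq t hc hσ (by decide : Odd 3), moment_X_sq_mul_S_sq,
    moment_X_pow_four_mul_S_sq, pow_zero, one_mul, ← normSq_eq, D]
  ring

/-- The explicit form of the ladder function `B_n`. -/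
def explicitB (c t σ : ℝ) (n : ℤ) (x : ℝ) : ℝ :=
  6 * c * γ c t σ n * x ^ 3 + (6 * c * Ξ c t σ n + 4 * t * γ c t σ n) * x + (2 * σ + 1) * Ω n / x

include hc hσ in
theorem B_eq_explicitB {x : ℝ} (hx : x ≠ 0) (n : ℕ) : B c t σ n x = explicitB c t σ n x := by
  cases n with
  | zero => simp [B_zero, explicitB, γ_of_nonpos, Ξ, Ω]
  | succ n =>
    have hN := (normSq_pos t hc hσ n).ne'
    refine mul_left_cancel₀ hN ?_
    rw [Nat.cast_add_one, normSq_mul_B t hc hσ hx, ladder_apply, invMoment_S_succ_mul_S,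
      moment_dividedPotential_mul,
      moment_even_pow_mul_S_succ_mul_S t hc hσ (by decide : Even 0),
      moment_even_pow_mul_S_succ_mul_S t hc hσ (by decide : Even 2),
      moment_even_pow_mul_S_succ_mul_S t hc hσ (by decide : Even 4), pow_one,
      moment_X_mul_S_succ_mul_S, moment_X_pow_three_mul_S_succ_mul_S, explicitB]
    ring

/-! ### The Christoffel-Darboux kernel -/

/-- The kernel `τ ↦ ∑_{k<n} S_k(x) S_k(τ) / Γ_k`. -/
def christoffelDarboux (c t σ x : ℝ) (n : ℕ) : ℝ[X] :=
  ∑ k ∈ Finset.range n, ((S c t σ k).eval x / normSq c t σ k) • S c t σ k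

/-- This is the reproducing property; by linearity it suffices to test it on `S_0, …, S_{n-1}`. -/
theorem moment_christoffelDarboux_mul (x : ℝ) {n : ℕ} {p : ℝ[X]}
    (hp : p.degree < (n : WithBot ℕ)) :
    moment t hc hσ (christoffelDarboux c t σ x n * p) = p.eval x := by
  have := linearMap_eq_zero_of_monicOP (c := c) (σ := σ) t
    (φ := moment t hc hσ ∘ₗ LinearMap.mulLeft ℝ (christoffelDarboux c t σ x n) - leval x)
    (fun k hk => ?_) hp
  · exact sub_eq_zero.mp this
  · rw [LinearMap.sub_apply, LinearMap.comp_apply, LinearMap.mulLeft_apply, leval_apply,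
      christoffelDarboux, Finset.sum_mul, map_sum, ← S_natCast]
    simp only [smul_mul_assoc, map_smul, smul_eq_mul]
    rw [Finset.sum_eq_single k (fun j _ hj => by
        rw [moment_S_mul_S t hc hσ (by exact_mod_cast hj), mul_zero])
      (fun h => absurd (Finset.mem_range.mpr hk) h), ← normSq_eq,
      div_mul_cancel₀ _ (normSq_pos t hc hσ k).ne', sub_self]

include hc hσ in
theorem sub_mul_christoffelDarboux (x : ℝ) (n : ℕ) :
    normSq c t σ n • ((C x - X) * christoffelDarboux c t σ x (n + 1)) =
      (S c t σ (n + 1)).eval x • S c t σ n - (S c t σ n).eval x • S c t σ (n + 1) := by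
  induction n with
  | zero =>
    have h := X_mul_S t hc hσ 0
    rw [γ_of_nonpos c t σ (n := ((0 : ℕ) : ℤ)) (by simp), C_0, zero_mul, add_zero, Nat.cast_zero,
      S_zero, mul_one] at h
    have hN := (normSq_pos t hc hσ 0).ne'
    rw [Nat.cast_zero] at hN ⊢
    rw [← h, christoffelDarboux, Finset.sum_range_one, Nat.cast_zero, S_zero, mul_smul_comm,
      smul_smul]
    simp [hN, smul_eq_C_mul]
  | succ n ih =>
    have hN := (normSq_pos t hc hσ (n + 1)).ne'
    have hX := X_mul_S_succ t hc hσ n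
    have hx := congrArg (eval x) hX
    simp only [eval_mul, eval_X, eval_add, eval_C] at hx
    have hlast : normSq c t σ (n + 1) •
        ((C x - X) * (((S c t σ (n + 1)).eval x / normSq c t σ (n + 1)) • S c t σ (n + 1))) =
        (S c t σ (n + 1)).eval x • ((C x - X) * S c t σ (n + 1)) := by
      rw [mul_smul_comm, smul_smul, mul_div_cancel₀ _ (by exact_mod_cast hN)]
    rw [christoffelDarboux, Finset.sum_range_succ, ← christoffelDarboux, Nat.cast_add_one, mul_add,
      smul_add, hlast, normSq_succ t hc hσ, mul_smul, ih, add_assoc (n : ℤ),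
      one_add_one_eq_two]
    simp only [smul_eq_C_mul]
    have hx' := congrArg C hx
    simp only [map_mul, map_add] at hx'
    linear_combination S c t σ (n + 1) * hx' - C ((S c t σ (n + 1)).eval x) * hX

/-! ### The ladder relations -/

-- In `ladder_sub_mul` take `f = K S_{n+1}`, with `K` the kernel of degree at most `n`.
-- Orthogonality kills `∫ f W_σ` and `∫ K' S_{n+1} W_σ`, and the reproducing property gives `∫ K
-- S_{n+1}' W_σ = S_{n+1}'(x)`. On the other side the Christoffel-Darboux formula splits `(x - τ) K
-- S_{n+1}` into the products that define `B_{n+1}` and `A_{n+1}`.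
include hc hσ in
theorem eval_derivative_S_succ {x : ℝ} (hx : x ≠ 0) (n : ℕ) :
    (derivative (S c t σ (n + 1))).eval x = -B c t σ (n + 1) x * (S c t σ (n + 1)).eval x
      + γ c t σ (n + 1) * A c t σ (n + 1) x * (S c t σ n).eval x := by
  have hN := (normSq_pos t hc hσ n).ne'
  set K := christoffelDarboux c t σ x (n + 1) with hK
  have hKdeg : K.degree < ((n + 1 : ℕ) : WithBot ℕ) := by
    rw [← mem_degreeLT, hK, christoffelDarboux]
    refine Submodule.sum_mem _ fun k hk => Submodule.smul_mem _ _ (mem_degreeLT.mpr ?_)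
    rw [S_natCast, degree_monicOP]
    exact_mod_cast Finset.mem_range.mp hk
  have h := ladder_sub_mul t hc hσ hx (K * S c t σ (n + 1))
  have h1 : moment t hc hσ (K * S c t σ (n + 1)) = 0 := by
    rw [mul_comm]
    exact moment_mul_monicOP_eq_zero t hc hσ hKdeg
  have h2 : moment t hc hσ (derivative K * S c t σ (n + 1)) = 0 := by
    rw [mul_comm]
    exact moment_mul_monicOP_eq_zero t hc hσ (lt_of_le_of_lt degree_derivative_le hKdeg)
  have h3 : moment t hc hσ (K * derivative (S c t σ (n + 1))) =
      (derivative (S c t σ (n + 1))).eval x := by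
    refine moment_christoffelDarboux_mul t hc hσ x ?_
    rw [S_natCast_add_one]
    have := degree_derivative_lt (monicOP_monic c t σ (n + 1)).ne_zero
    rwa [degree_monicOP] at this
  rw [derivative_mul, map_add, h1, h2, h3, mul_zero, zero_add, zero_sub, ← mul_assoc] at h
  have h4 : normSq c t σ n • ((C x - X) * K * S c t σ (n + 1)) =
      (S c t σ (n + 1)).eval x • (S c t σ (n + 1) * S c t σ n)
        - (S c t σ n).eval x • (S c t σ (n + 1) * S c t σ (n + 1)) := by
    rw [← smul_mul_assoc, sub_mul_christoffelDarboux t hc hσ, sub_mul, smul_mul_assoc,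
      smul_mul_assoc, mul_comm (S c t σ n)]
  have h5 := congrArg (ladder t hc hσ x) h4
  have h6 := normSq_mul_A t hc hσ hx (n + 1)
  rw [Nat.cast_add_one, normSq_succ t hc hσ] at h6
  rw [map_sub, map_smul, map_smul, map_smul, h, ← normSq_mul_B t hc hσ hx, ← h6] at h5
  simp only [smul_eq_mul] at h5
  refine mul_left_cancel₀ hN ?_
  linear_combination -h5

include hc hσ in
theorem eval_derivative_S {x : ℝ} (hx : x ≠ 0) (n : ℕ) :
    (derivative (S c t σ n)).eval x = -B c t σ n x * (S c t σ n).eval x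
      + γ c t σ n * A c t σ n x * (S c t σ (n - 1)).eval x := by
  cases n with
  | zero => simp [S_zero, B_zero, γ_of_nonpos]
  | succ n =>
    rw [Nat.cast_add_one, add_sub_cancel_right]
    exact eval_derivative_S_succ t hc hσ hx n

include hc hσ in
theorem B_succ_add_B {x : ℝ} (hx : x ≠ 0) (n : ℕ) :
    B c t σ (n + 1) x + B c t σ n x = x * A c t σ n x - deriv (v c t σ) x := by
  have hN := (normSq_pos t hc hσ n).ne'
  have h := ladder_sub_mul t hc hσ hx (S c t σ n * S c t σ n)
  have h0 : moment t hc hσ (derivative (S c t σ n * S c t σ n)) = 0 := by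
    have : moment t hc hσ (S c t σ n * derivative (S c t σ n)) = 0 := by
      refine moment_mul_monicOP_eq_zero t hc hσ ?_
      have := degree_derivative_lt (monicOP_monic c t σ n).ne_zero
      rwa [degree_monicOP] at this
    rw [derivative_mul, mul_comm, map_add, this, add_zero]
  have e : (C x - X) * (S c t σ n * S c t σ n) = x • (S c t σ n * S c t σ n)
      - S c t σ (n + 1) * S c t σ n - γ c t σ n • (S c t σ n * S c t σ (n - 1)) := by
    have := X_mul_S t hc hσ n
    simp only [smul_eq_C_mul]
    linear_combination -S c t σ n * this
  -- The factor `γ_n` converts the normalization `Γ_{n-1}` of `B_n` into `Γ_n`; at `n = 0` both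
  -- sides are zero.
  have hB : γ c t σ n * ladder t hc hσ x (S c t σ n * S c t σ (n - 1)) =
      normSq c t σ n * B c t σ n x := by
    cases n with
    | zero => simp [γ_of_nonpos, B_zero]
    | succ n =>
      rw [Nat.cast_add_one, add_sub_cancel_right, ← normSq_mul_B t hc hσ hx,
        normSq_succ t hc hσ, mul_assoc]
  rw [e, h0, map_sub, map_sub, map_smul, map_smul, smul_eq_mul, smul_eq_mul,
    ← normSq_mul_A t hc hσ hx, ← normSq_mul_B t hc hσ hx, hB, ← normSq_eq] at h
  refine mul_left_cancel₀ hN ?_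
  linear_combination -h

-- Replace `γ_n S_{n-1}` by `x S_n - S_{n+1}` in the first ladder relation, then `x A_n - B_n` by
-- `B_{n+1} + v'`. Shifted by one index, this supplies the derivative of `S_{n-1}`.
include hc hσ in
theorem eval_derivative_S_lowering {x : ℝ} (hx : x ≠ 0) (n : ℕ) :
    (derivative (S c t σ n)).eval x =
      (B c t σ (n + 1) x + deriv (v c t σ) x) * (S c t σ n).eval x
        - A c t σ n x * (S c t σ (n + 1)).eval x := by
  have h1 := eval_derivative_S t hc hσ hx n
  have h2 := B_succ_add_B t hc hσ hx n
  have h3 := congrArg (eval x) (S_succ t hc hσ n)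
  simp only [eval_sub, eval_mul, eval_X, eval_C] at h3
  rw [h3]
  linear_combination h1 - (S c t σ n).eval x * h2

/-! ### The differential equation -/

/-- The derivative of the polynomial `D_n`. -/
def derivD (c t σ : ℝ) (n : ℤ) (x : ℝ) : ℝ :=
  24 * c * x ^ 3 + 2 * (6 * c * (γ c t σ n + γ c t σ (n + 1)) + 4 * t) * x

theorem hasDerivAt_D (c t σ : ℝ) (n : ℤ) (x : ℝ) :
    HasDerivAt (D c t σ n) (derivD c t σ n x) x := by
  have h4 := (hasDerivAt_pow 4 x).const_mul (6 * c)
  have h2 := (hasDerivAt_pow 2 x).const_mul (6 * c * (γ c t σ n + γ c t σ (n + 1)))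
  have h2' := ((((hasDerivAt_pow 2 x).add_const (γ c t σ n)).add_const
    (γ c t σ (n + 1))).const_mul (4 * t))
  refine ((((h4.add h2).add_const (6 * c * (Ξ c t σ (n + 1) + Ξ c t σ n))).sub_const
    (2 * t)).add h2').congr_deriv ?_
  rw [derivD]
  push_cast
  ring

theorem hasDerivAt_explicitB (c t σ : ℝ) (n : ℤ) {x : ℝ} (hx : x ≠ 0) :
    HasDerivAt (explicitB c t σ n)
      (18 * c * γ c t σ n * x ^ 2 + 6 * c * Ξ c t σ n + 4 * t * γ c t σ n
        - (2 * σ + 1) * Ω n / x ^ 2) x := by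
  have h3 := (hasDerivAt_pow 3 x).const_mul (6 * c * γ c t σ n)
  have h1 := (hasDerivAt_id x).const_mul (6 * c * Ξ c t σ n + 4 * t * γ c t σ n)
  have h0 := (hasDerivAt_inv hx).const_mul ((2 * σ + 1) * Ω n)
  refine ((h3.add h1).add h0).congr_deriv ?_
  push_cast
  field_simp
  ring

include hc hσ in
theorem hasDerivAt_A {x : ℝ} (hx : x ≠ 0) (n : ℕ) :
    HasDerivAt (A c t σ n) (derivD c t σ n x) x :=
  (hasDerivAt_D c t σ n x).congr_of_eventuallyEq
    ((eventually_ne_nhds hx).mono fun _ hy => A_eq_D t hc hσ hy n)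

include hc hσ in
theorem hasDerivAt_B {x : ℝ} (hx : x ≠ 0) (n : ℕ) :
    HasDerivAt (B c t σ n)
      (18 * c * γ c t σ n * x ^ 2 + 6 * c * Ξ c t σ n + 4 * t * γ c t σ n
        - (2 * σ + 1) * Ω n / x ^ 2) x :=
  (hasDerivAt_explicitB c t σ n hx).congr_of_eventuallyEq
    ((eventually_ne_nhds hx).mono fun _ hy => B_eq_explicitB t hc hσ hy n)

include hc hσ in
theorem eval_derivative_derivative_S {x : ℝ} (hx : x ≠ 0) (n : ℕ) :
    (derivative (derivative (S c t σ n))).eval x =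
      -(deriv (B c t σ n) x * (S c t σ n).eval x
          + B c t σ n x * (derivative (S c t σ n)).eval x)
        + γ c t σ n * (deriv (A c t σ n) x * (S c t σ (n - 1)).eval x
          + A c t σ n x * (derivative (S c t σ (n - 1))).eval x) := by
  have hA := (hasDerivAt_A t hc hσ hx n).differentiableAt.hasDerivAt
  have hB := (hasDerivAt_B t hc hσ hx n).differentiableAt.hasDerivAt
  have h := (hB.mul ((S c t σ n).hasDerivAt x)).neg.add
    ((hA.mul ((S c t σ (n - 1)).hasDerivAt x)).const_mul (γ c t σ n))
  refine ((derivative (S c t σ n)).hasDerivAt x).unique (h.congr_of_eventuallyEq ?_)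
  -- The ladder relation holds only off the origin, but that is a neighbourhood of `x`, which is
  -- enough to differentiate it.
  refine (eventually_ne_nhds hx).mono fun y hy => ?_
  simp only [eval_derivative_S t hc hσ hy, Pi.add_apply, Pi.neg_apply, Pi.mul_apply]
  ring

include hc hσ in
theorem γ_mul_eval_derivative_S_pred {x : ℝ} (hx : x ≠ 0) (n : ℕ) :
    γ c t σ n * (derivative (S c t σ (n - 1))).eval x =
      γ c t σ n * ((B c t σ n x + deriv (v c t σ) x) * (S c t σ (n - 1)).eval x
        - A c t σ (n - 1) x * (S c t σ n).eval x) := by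
  cases n with
  | zero => simp [γ_of_nonpos]
  | succ n =>
    rw [Nat.cast_add_one, add_sub_cancel_right, eval_derivative_S_lowering t hc hσ hx]

include hc hσ in
theorem ladder_differential_equation {x : ℝ} (hx : x ≠ 0) (n : ℕ) (hA : A c t σ n x ≠ 0) :
    (derivative (derivative (S c t σ n))).eval x
      + (-deriv (v c t σ) x - deriv (A c t σ n) x / A c t σ n x)
          * (derivative (S c t σ n)).eval x
      + (-B c t σ n x * (deriv (v c t σ) x + B c t σ n x + deriv (A c t σ n) x / A c t σ n x)
          + γ c t σ n * A c t σ n x * A c t σ (n - 1) x + deriv (B c t σ n) x)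
          * (S c t σ n).eval x = 0 := by
  have h1 := eval_derivative_S t hc hσ hx n
  have h2 := eval_derivative_derivative_S t hc hσ hx n
  have h3 := γ_mul_eval_derivative_S_pred t hc hσ hx n
  -- The first ladder relation is solved for `γ_n S_{n-1}`; this is where `A_n(x) ≠ 0` enters.
  have hr : γ c t σ n * (S c t σ (n - 1)).eval x =
      ((derivative (S c t σ n)).eval x + B c t σ n x * (S c t σ n).eval x) / A c t σ n x := by
    rw [eq_div_iff hA]
    linear_combination -h1
  have h2' : (derivative (derivative (S c t σ n))).eval x =
      -(deriv (B c t σ n) x * (S c t σ n).eval x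
          + B c t σ n x * (derivative (S c t σ n)).eval x)
        + deriv (A c t σ n) x * (γ c t σ n * (S c t σ (n - 1)).eval x)
        + A c t σ n x * ((B c t σ n x + deriv (v c t σ) x)
            * (γ c t σ n * (S c t σ (n - 1)).eval x)
          - γ c t σ n * A c t σ (n - 1) x * (S c t σ n).eval x) := by
    linear_combination h2 + A c t σ n x * h3
  rw [h2', hr]
  field_simp
  ring

include hc hσ in
theorem U_eq {x : ℝ} (hx : x ≠ 0) (n : ℕ) :
    U c t σ n x = -deriv (v c t σ) x - deriv (A c t σ n) x / A c t σ n x := by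
  rw [U, (hasDerivAt_A t hc hσ hx n).deriv, A_eq_D t hc hσ hx, deriv_v c t hσ hx,
    eval_potentialPoly, derivD]
  ring

-- At `n = 0` the polynomial `D_{-1}` need not agree with `A_{-1} = 0`; the factor `γ_0 = 0` hides
-- the mismatch.
include hc hσ in
theorem γ_mul_A_pred {x : ℝ} (hx : x ≠ 0) (n : ℕ) :
    γ c t σ n * A c t σ (n - 1) x = γ c t σ n * D c t σ (n - 1) x := by
  cases n with
  | zero => simp [γ_of_nonpos]
  | succ n => rw [Nat.cast_add_one, add_sub_cancel_right, A_eq_D t hc hσ hx]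

include hc hσ in
theorem W_eq {x : ℝ} (hx : x ≠ 0) (n : ℕ) :
    W c t σ n x = -B c t σ n x
        * (deriv (v c t σ) x + B c t σ n x + deriv (A c t σ n) x / A c t σ n x)
      + γ c t σ n * A c t σ n x * A c t σ (n - 1) x + deriv (B c t σ n) x := by
  rw [mul_right_comm, γ_mul_A_pred t hc hσ hx, (hasDerivAt_A t hc hσ hx n).deriv,
    (hasDerivAt_B t hc hσ hx n).deriv, A_eq_D t hc hσ hx, B_eq_explicitB t hc hσ hx,
    deriv_v c t hσ hx, eval_potentialPoly, W, ← derivD, explicitB]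
  -- The quotient `D_n'/D_n` occurs identically on both sides, so the identity needs no assumption
  -- that `D_n(x)` is nonzero.
  generalize derivD c t σ n x / D c t σ n x = r
  simp only [D, sub_add_cancel]
  ring

theorem finite_D_eq_zero (hc : c ≠ 0) (t σ : ℝ) (n : ℤ) : {x : ℝ | D c t σ n x = 0}.Finite := by
  set a := 6 * c * (γ c t σ n + γ c t σ (n + 1)) + 4 * t with ha
  set b := 6 * c * (Ξ c t σ (n + 1) + Ξ c t σ n) - 2 * t
    + 4 * t * (γ c t σ n + γ c t σ (n + 1)) with hb
  set p : ℝ[X] := C (6 * c) * X ^ 4 + C a * X ^ 2 + C b with hp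
  have hp0 : p ≠ 0 := fun h => by
    -- The coefficient of `X⁴` is `6c`, which is nonzero whatever the `γ`'s are.
    have := congrArg (fun q => coeff q 4) h
    simp [hp, -map_mul, coeff_X_pow, hc] at this
  refine (p.roots.toFinset.finite_toSet).subset fun x hx => ?_
  rw [Finset.mem_coe, Multiset.mem_toFinset, mem_roots hp0, IsRoot.def]
  simp only [hp, eval_add, eval_mul, eval_C, eval_pow, eval_X]
  rw [← show D c t σ n x = 0 from hx, D, ha, hb]
  ring

include hc hσ in
theorem isMonicOrthogonal_S : IsMonicOrthogonal c t σ (fun n : ℕ => S c t σ n) where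
  monic := monicOP_monic c t σ
  natDegree := natDegree_monicOP c t σ
  integrable m n := by
    simpa only [eval_mul] using integrable_eval_mul_weight t hc hσ (S c t σ m * S c t σ n)
  orthogonal m n h := by
    rw [pairing_eq_moment t hc hσ]
    exact moment_monicOP_mul_of_ne t hc hσ h
  pos n := normSq_pos t hc hσ n

end

end SexticFreud

theorem mainTheorem4 (c t σ : ℝ) (hc : 0 < c) (hσ : 0 < σ) :
    -- the `S n` are the monic orthogonal polynomials, and the `γ n` their recurrence coefficients
    SexticFreud.IsMonicOrthogonal c t σ (fun n : ℕ => SexticFreud.S c t σ n) ∧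
    (∀ n : ℕ, SexticFreud.S c t σ (n + 1) =
      Polynomial.X * SexticFreud.S c t σ n
        - Polynomial.C (SexticFreud.γ c t σ n) * SexticFreud.S c t σ (n - 1)) ∧
    ∀ n : ℕ,
      -- the denominator has only finitely many zeros
      {x : ℝ | SexticFreud.D c t σ n x = 0}.Finite ∧
      ∀ x : ℝ, x ≠ 0 → SexticFreud.D c t σ n x ≠ 0 →
        -- the differential equation with the explicit rational coefficients
        (Polynomial.derivative (Polynomial.derivative (SexticFreud.S c t σ n))).eval x
            + SexticFreud.U c t σ n x * (Polynomial.derivative (SexticFreud.S c t σ n)).eval x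
            + SexticFreud.W c t σ n x * (SexticFreud.S c t σ n).eval x = 0 ∧
        -- the denominator is the ladder function `A n`
        SexticFreud.A c t σ n x = SexticFreud.D c t σ n x ∧
        -- the coefficients in terms of the ladder functions
        SexticFreud.U c t σ n x =
          -deriv (SexticFreud.v c t σ) x
            - deriv (SexticFreud.A c t σ n) x / SexticFreud.A c t σ n x ∧
        SexticFreud.W c t σ n x =
          -SexticFreud.B c t σ n x
              * (deriv (SexticFreud.v c t σ) x + SexticFreud.B c t σ n x
                + deriv (SexticFreud.A c t σ n) x / SexticFreud.A c t σ n x)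
            + SexticFreud.γ c t σ n * SexticFreud.A c t σ n x * SexticFreud.A c t σ (n - 1) x
            + deriv (SexticFreud.B c t σ n) x := by
  refine ⟨SexticFreud.isMonicOrthogonal_S t hc hσ, SexticFreud.S_succ t hc hσ, fun n =>
    ⟨SexticFreud.finite_D_eq_zero hc.ne' t σ n, fun x hx hD => ?_⟩⟩
  have hA := SexticFreud.A_eq_D t hc hσ hx n
  have hU := SexticFreud.U_eq t hc hσ hx n
  have hW := SexticFreud.W_eq t hc hσ hx n
  refine ⟨?_, hA, hU, hW⟩
  rw [hU, hW]
  exact SexticFreud.ladder_differential_equation t hc hσ hx n (hA ▸ hD)
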